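/- Let $n\ge 1$ and let $\Delta$ be a non-degenerate simplex in Euclidean space $\mathbb{E}^n$ with (affinely independent) vertices $v_0,\dots,v_n$. For $0\le i\le n$ let $f_i$ be the unit outer normal of $\Delta$ at its $i$-th facet (the facet opposite to $v_i$), and let $A_i$ be the area, i.e. the $(n-1)$-dimensional volume, of that facet (for $n=1$ the facets are points, of area $1$). Let $G^*$ be the dual Gram matrix of $\Delta$, the $(n+1)\times(n+1)$ matrix with entries $G^*_{ij}=\langle f_i,f_j\rangle$. Then: 1. $G^*$ is symmetric and positive semidefinite, and $0$ is an eigenvalue of $G^*$ of multiplicity exactly one; in particular, the null space of $G^*$ is one-dimensional. 2. $\sum_{i=0}^n A_i f_i = 0$. 3. The null space of $G^*$ is spanned by the vector of facet areas $(A_0,\dots,A_n)$. -/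

import Mathlib

namespace EuclideanSimplex

open MeasureTheory

/-- `f` is a unit outer normal of the simplex `s` at the facet opposite to its `i`-th vertex:
a unit vector, orthogonal to the facet, and such that the simplex lies on the side of the facet
to which `f` does not point. -/
structure IsUnitOuterNormal {n : ℕ} [NeZero n]
    (s : Affine.Simplex ℝ (EuclideanSpace ℝ (Fin n)) n) (i : Fin (n + 1))
    (f : EuclideanSpace ℝ (Fin n)) : Prop where
  norm_eq_one : ‖f‖ = 1
  inner_facet : ∀ p ∈ (s.faceOpposite i).closedInterior, ∀ q ∈ (s.faceOpposite i).closedInterior,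
    inner ℝ f (q - p) = 0
  inner_simplex : ∀ p ∈ (s.faceOpposite i).closedInterior, ∀ x ∈ s.closedInterior,
    inner ℝ f (x - p) ≤ 0

/-- Each facet of a full-dimensional simplex has exactly one unit outer normal. -/
theorem existsUnique_isUnitOuterNormal {n : ℕ} [NeZero n]
    (s : Affine.Simplex ℝ (EuclideanSpace ℝ (Fin n)) n) (i : Fin (n + 1)) :
    ∃! f : EuclideanSpace ℝ (Fin n), IsUnitOuterNormal s i f := by
  have hmem : ∀ j, j ≠ i → s.points j ∈ (s.faceOpposite i).closedInterior := by
    intro j hj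
    have : s.points j ∈ Set.range (s.faceOpposite i).points := by
      rw [Affine.Simplex.range_faceOpposite_points]
      exact ⟨j, hj, rfl⟩
    obtain ⟨k, hk⟩ := this
    rw [← hk]
    exact (s.faceOpposite i).point_mem_closedInterior k
  have hspan : vectorSpan ℝ (Set.range s.points) = ⊤ := by
    apply s.independent.vectorSpan_eq_top_of_card_eq_finrank_add_one
    simp
  obtain ⟨j, hj⟩ : ∃ j : Fin (n + 1), j ≠ i := by
    have : Nontrivial (Fin (n + 1)) := Fin.nontrivial_iff_two_le.2 (by
      have := NeZero.pos n
      omega)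
    exact exists_ne i
  -- a vector orthogonal to the facet and to one transversal direction vanishes
  have hzero : ∀ g : EuclideanSpace ℝ (Fin n),
      (∀ p ∈ (s.faceOpposite i).closedInterior, ∀ q ∈ (s.faceOpposite i).closedInterior,
        inner ℝ g (q - p) = 0) → inner ℝ g (s.points i - s.points j) = 0 → g = 0 := by
    intro g h1 h2
    have hle : vectorSpan ℝ (Set.range s.points) ≤ (ℝ ∙ g)ᗮ := by
      rw [vectorSpan_range_eq_span_range_vsub_right ℝ s.points j, Submodule.span_le]
      rintro _ ⟨k, rfl⟩
      rw [SetLike.mem_coe, Submodule.mem_orthogonal_singleton_iff_inner_right]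
      by_cases hk : k = i
      · subst hk
        simpa using h2
      · simpa using h1 _ (hmem j hj) _ (hmem k hk)
    rw [hspan] at hle
    have := hle (Submodule.mem_top (x := g))
    rw [Submodule.mem_orthogonal_singleton_iff_inner_right] at this
    exact inner_self_eq_zero.1 this
  have hsub : ∀ p ∈ (s.faceOpposite i).closedInterior,
      p ∈ affineSpan ℝ (Set.range (s.faceOpposite i).points) := fun p hp =>
    Affine.Simplex.closedInterior_subset_affineSpan hp
  -- existence
  have hex : ∃ f : EuclideanSpace ℝ (Fin n), IsUnitOuterNormal s i f := by
    set a := s.altitudeFoot i with ha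
    have hne : s.points i ≠ a := s.ne_altitudeFoot i
    set f := a - s.points i with hf
    have hf0 : f ≠ 0 := sub_ne_zero.2 hne.symm
    have hafoot : a ∈ affineSpan ℝ (Set.range (s.faceOpposite i).points) :=
      s.altitudeFoot_mem_affineSpan_faceOpposite i
    have horth : ∀ p ∈ affineSpan ℝ (Set.range (s.faceOpposite i).points),
        ∀ q ∈ affineSpan ℝ (Set.range (s.faceOpposite i).points), inner ℝ f (q - p) = 0 := by
      intro p hp q hq
      have h := EuclideanGeometry.vsub_orthogonalProjection_mem_direction_orthogonal
        (affineSpan ℝ (Set.range (s.faceOpposite i).points)) (s.points i)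
      rw [Submodule.mem_orthogonal'] at h
      have h2 := h (q - p) (AffineSubspace.vsub_mem_direction hq hp)
      have h3 : f = -(s.points i - a) := by rw [hf]; abel
      rw [h3, inner_neg_left, neg_eq_zero]
      exact h2
    have hin : ∀ p ∈ affineSpan ℝ (Set.range (s.faceOpposite i).points),
        ∀ x ∈ s.closedInterior, inner ℝ f (x - p) ≤ 0 := by
      intro p hp x hx
      rw [← s.convexHull_eq_closedInterior] at hx
      have hsubset : convexHull ℝ (Set.range s.points) ⊆ {y | inner ℝ f y ≤ inner ℝ f p} := by
        apply convexHull_min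
        · rintro _ ⟨k, rfl⟩
          rw [Set.mem_ofPred_eq]
          by_cases hk : k = i
          · subst hk
            have e : s.points k = p + ((a - p) - f) := by rw [hf]; abel
            rw [e, inner_add_right, inner_sub_right, horth p hp a hafoot]
            have := real_inner_self_nonneg (x := f)
            linarith
          · have := horth p hp _ (hsub _ (hmem k hk))
            rw [inner_sub_right] at this
            linarith
        · exact convex_halfSpace_le (innerSL ℝ f).toLinearMap.isLinear _
      have := hsubset hx
      rw [Set.mem_ofPred_eq] at this
      rw [inner_sub_right]
      linarith
    refine ⟨‖f‖⁻¹ • f, ?_, ?_, ?_⟩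
    · rw [norm_smul, norm_inv, norm_norm, inv_mul_cancel₀ (norm_ne_zero_iff.2 hf0)]
    · intro p hp q hq
      rw [real_inner_smul_left, horth p (hsub p hp) q (hsub q hq), mul_zero]
    · intro p hp x hx
      rw [real_inner_smul_left]
      exact mul_nonpos_of_nonneg_of_nonpos (by positivity) (hin p (hsub p hp) x hx)
  -- uniqueness
  obtain ⟨f, hf⟩ := hex
  refine ⟨f, hf, ?_⟩
  intro g hg
  have hfd := hf.inner_simplex _ (hmem j hj) _ (s.point_mem_closedInterior i)
  have hgd := hg.inner_simplex _ (hmem j hj) _ (s.point_mem_closedInterior i)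
  set d := s.points i - s.points j with hd
  have hgd0 : inner ℝ g d ≠ 0 := by
    intro h
    have h0 := hzero g hg.inner_facet h
    have := hg.norm_eq_one
    rw [h0, norm_zero] at this
    exact zero_ne_one this
  have hcomb : inner ℝ g d • f - inner ℝ f d • g = 0 := by
    apply hzero
    · intro p hp q hq
      rw [inner_sub_left, real_inner_smul_left, real_inner_smul_left,
        hf.inner_facet p hp q hq, hg.inner_facet p hp q hq]
      simp
    · rw [inner_sub_left, real_inner_smul_left, real_inner_smul_left]
      ring
  have heq : inner ℝ g d • f = inner ℝ f d • g := sub_eq_zero.1 hcomb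
  have hnorm := congrArg norm heq
  rw [norm_smul, norm_smul, hf.norm_eq_one, hg.norm_eq_one, mul_one, mul_one, Real.norm_eq_abs,
    Real.norm_eq_abs, abs_of_nonpos hfd, abs_of_nonpos hgd] at hnorm
  have hv : inner ℝ g d = inner ℝ f d := by linarith
  rw [← hv] at heq
  exact (smul_right_injective _ hgd0 heq).symm

/-- The unit outer normal of the simplex `s` at the facet opposite to its `i`-th vertex. -/
noncomputable def unitOuterNormal {n : ℕ} [NeZero n]
    (s : Affine.Simplex ℝ (EuclideanSpace ℝ (Fin n)) n) (i : Fin (n + 1)) :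
    EuclideanSpace ℝ (Fin n) :=
  (existsUnique_isUnitOuterNormal s i).choose

theorem unitOuterNormal_spec {n : ℕ} [NeZero n]
    (s : Affine.Simplex ℝ (EuclideanSpace ℝ (Fin n)) n) (i : Fin (n + 1)) :
    IsUnitOuterNormal s i (unitOuterNormal s i) :=
  (existsUnique_isUnitOuterNormal s i).choose_spec.1

/-- The dual Gram matrix of a simplex: the inner products of its unit outer facet normals. -/
noncomputable def dualGram {n : ℕ} [NeZero n]
    (s : Affine.Simplex ℝ (EuclideanSpace ℝ (Fin n)) n) :
    Matrix (Fin (n + 1)) (Fin (n + 1)) ℝ :=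
  Matrix.of fun i j => inner ℝ (unitOuterNormal s i) (unitOuterNormal s j)

/-- The area of the facet opposite to the `i`-th vertex: its `(n - 1)`-dimensional Euclidean
volume (for `n = 1` a facet is a point and has area `1`). -/
noncomputable def facetArea {n : ℕ} [NeZero n]
    (s : Affine.Simplex ℝ (EuclideanSpace ℝ (Fin n)) n) (i : Fin (n + 1)) : ℝ :=
  (μHE[n - 1]).real (s.faceOpposite i).closedInterior

end EuclideanSimplex

namespace EuclideanSimplex

open MeasureTheory Module
open scoped Pointwise RealInnerProductSpace

/-! Everything rests on one fact: facet area times height, `A_i h_i`, does not depend on `i`. The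
number `A_i h_i` is the volume of a prism over facet `i` whose generating segment is parallel to an
edge `v_i - v_j`. The linear reflection negating that edge and exchanging `v_i` and `v_j` up to
translation preserves volume and carries this prism to the one over facet `j` (`volume_prism_comm`).
Moreover `-f_i / h_i` is the linear part of the `i`-th barycentric coordinate
(`inner_unitOuterNormal`). Pairing `∑ x_i f_i` with edges therefore shows that it vanishes exactly
when `x_i h_i` is constant, that is, when `x` is a multiple of `A`. Since a Gram matrix kills
precisely the linear relations among its vectors, this determines the kernel; symmetry turns its
dimension into the algebraic multiplicity of `0`. -/

/-- The volume of a prism: base area times the length of the projection of the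
generating segment to the normal of the base. -/
theorem volume_add_segment {n : ℕ} {C : Set (EuclideanSpace ℝ (Fin n))} (hC : IsCompact C)
    {f : EuclideanSpace ℝ (Fin n)} (hf : ‖f‖ = 1) {p : EuclideanSpace ℝ (Fin n)}
    (hp : ∀ q ∈ C, ⟪f, q - p⟫ = 0) {w : EuclideanSpace ℝ (Fin n)} (hw : ⟪f, w⟫ ≠ 0) :
    volume (C + segment ℝ 0 w) = μHE[n - 1] C * ENNReal.ofReal |⟪f, w⟫| := by
  set a : ℝ := ⟪f, w⟫ with ha
  have hf0 : f ≠ 0 := by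
    rintro rfl
    simp at hf
  have hseg : IsCompact (segment ℝ 0 w) := by
    rw [← convexHull_pair]
    exact (Set.toFinite _).isCompact_convexHull ℝ
  have hmem : ∀ x : ℝ, ∀ z : EuclideanSpace ℝ (Fin n),
      z ∈ AffineSubspace.mk' (x • f +ᵥ p) (ℝ ∙ f)ᗮ ↔ ⟪f, z - p⟫ = x := by
    intro x z
    rw [AffineSubspace.mem_mk', Submodule.mem_orthogonal_singleton_iff_inner_right, vsub_eq_sub,
      vadd_eq_add, show z - (x • f + p) = (z - p) - x • f by abel, inner_sub_right,
      real_inner_smul_right, real_inner_self_eq_norm_sq, hf]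
    constructor <;> intro h <;> linarith
  -- The slice at height `x` is the translate of `C` by `(x / a) • w` when `x / a ∈ [0, 1]`, and
  -- empty otherwise. Cavalieri's principle then integrates a constant over an interval of length
  -- `|a|`.
  have hslice : ∀ x : ℝ, μHE[n - 1] ((C + segment ℝ 0 w) ∩
      (AffineSubspace.mk' (x • f +ᵥ p) (ℝ ∙ f)ᗮ : Set (EuclideanSpace ℝ (Fin n)))) =
      ((· * a⁻¹) ⁻¹' Set.Icc (0 : ℝ) 1).indicator (fun _ => μHE[n - 1] C) x := by
    intro x
    by_cases hx : x * a⁻¹ ∈ Set.Icc (0 : ℝ) 1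
    · rw [Set.indicator_of_mem (by exact hx), ← measure_vadd μHE[n - 1] ((x * a⁻¹) • w) C]
      congr 1
      ext z
      simp only [Set.mem_inter_iff, SetLike.mem_coe, hmem, segment_eq_image, smul_zero, zero_add]
      constructor
      · rintro ⟨⟨y, hy, _, ⟨t, ht, rfl⟩, rfl⟩, hz⟩
        have hz' : t * a = x := by
          rw [← hz, show y + t • w - p = (y - p) + t • w by abel, inner_add_right, hp y hy,
            real_inner_smul_right, zero_add]
        refine ⟨y, hy, ?_⟩
        simp only [vadd_eq_add, ← hz', mul_inv_cancel_right₀ hw, add_comm]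
      · rintro ⟨y, hy, rfl⟩
        refine ⟨⟨y, hy, _, ⟨_, hx, rfl⟩, by simp [add_comm]⟩, ?_⟩
        simp only [vadd_eq_add]
        rw [show (x * a⁻¹) • w + y - p = (y - p) + (x * a⁻¹) • w by abel, inner_add_right,
          hp y hy, real_inner_smul_right, zero_add, inv_mul_cancel_right₀ hw]
    · rw [Set.indicator_of_notMem (by exact hx)]
      rw [← measure_empty (μ := (μHE[n - 1] : Measure (EuclideanSpace ℝ (Fin n))))]
      congr 1
      rw [Set.eq_empty_iff_forall_notMem]
      rintro z ⟨⟨y, hy, _, hs, rfl⟩, hz⟩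
      rw [segment_eq_image] at hs
      obtain ⟨t, ht, rfl⟩ := hs
      simp only [SetLike.mem_coe, hmem, smul_zero, zero_add] at hz
      apply hx
      rwa [← hz, show y + t • w - p = (y - p) + t • w by abel, inner_add_right, hp y hy,
        real_inner_smul_right, zero_add, mul_inv_cancel_right₀ hw]
  have key := EuclideanGeometry.euclideanHausdorffMeasure_eq_lintegral p hf0
    (hC.add hseg).measurableSet
  rw [finrank_euclideanSpace_fin, EuclideanSpace.euclideanHausdorffMeasure_eq_volume] at key
  rw [key, ← ofReal_norm, hf, ENNReal.ofReal_one, one_mul, lintegral_congr hslice,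
    lintegral_indicator_const (measurableSet_Icc.preimage (by fun_prop)),
    Real.volume_preimage_mul_right (inv_ne_zero hw)]
  simp

/-! ### Pairing facet normals with edges -/

theorem eq_zero_of_inner_points_sub_eq_zero {n : ℕ}
    (s : Affine.Simplex ℝ (EuclideanSpace ℝ (Fin n)) n)
    {g : EuclideanSpace ℝ (Fin n)} (j : Fin (n + 1))
    (h : ∀ k, ⟪g, s.points k - s.points j⟫ = 0) : g = 0 := by
  have hspan : vectorSpan ℝ (Set.range s.points) = ⊤ := by
    apply s.independent.vectorSpan_eq_top_of_card_eq_finrank_add_one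
    simp
  have hle : vectorSpan ℝ (Set.range s.points) ≤ (ℝ ∙ g)ᗮ := by
    rw [vectorSpan_range_eq_span_range_vsub_right ℝ s.points j, Submodule.span_le]
    rintro _ ⟨k, rfl⟩
    rw [SetLike.mem_coe, Submodule.mem_orthogonal_singleton_iff_inner_right]
    exact h k
  rw [hspan] at hle
  have := hle (Submodule.mem_top (x := g))
  rw [Submodule.mem_orthogonal_singleton_iff_inner_right] at this
  exact inner_self_eq_zero.1 this

variable {n : ℕ} [NeZero n] (s : Affine.Simplex ℝ (EuclideanSpace ℝ (Fin n)) n)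

theorem closedInterior_faceOpposite (i : Fin (n + 1)) :
    (s.faceOpposite i).closedInterior = convexHull ℝ (s.points '' {i}ᶜ) := by
  rw [← Affine.Simplex.convexHull_eq_closedInterior, Affine.Simplex.range_faceOpposite_points]

theorem point_mem_closedInterior_faceOpposite {i j : Fin (n + 1)} (h : j ≠ i) :
    s.points j ∈ (s.faceOpposite i).closedInterior := by
  rw [closedInterior_faceOpposite]
  exact subset_convexHull ℝ _ ⟨j, h, rfl⟩

theorem isCompact_closedInterior_faceOpposite (i : Fin (n + 1)) :
    IsCompact (s.faceOpposite i).closedInterior := by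
  rw [closedInterior_faceOpposite]
  exact (Set.toFinite _).isCompact_convexHull ℝ

/-- The outer normals are, up to the heights of the simplex, dual to the vertices. -/
theorem exists_inner_unitOuterNormal (i : Fin (n + 1)) :
    ∃ h : ℝ, 0 < h ∧ ∀ k l, ⟪unitOuterNormal s i, s.points k - s.points l⟫ =
      h * ((if l = i then 1 else 0) - (if k = i then 1 else 0)) := by
  have hn := unitOuterNormal_spec s i
  set f := unitOuterNormal s i
  have : Nontrivial (Fin (n + 1)) := Fin.nontrivial_iff_two_le.2 (by
    have := NeZero.pos n
    omega)
  obtain ⟨j, hj⟩ := exists_ne i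
  have hfac : ∀ k, k ≠ i → ⟪f, s.points k⟫ = ⟪f, s.points j⟫ := fun k hk => by
    have := hn.inner_facet _ (point_mem_closedInterior_faceOpposite s hj) _
      (point_mem_closedInterior_faceOpposite s hk)
    rwa [inner_sub_right, sub_eq_zero] at this
  have hle := hn.inner_simplex _ (point_mem_closedInterior_faceOpposite s hj) _
    (s.point_mem_closedInterior i)
  rw [inner_sub_right] at hle
  refine ⟨⟪f, s.points j⟫ - ⟪f, s.points i⟫, lt_of_le_of_ne (by linarith) ?_, ?_⟩
  · intro h0
    have hf0 : f = 0 := by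
      refine eq_zero_of_inner_points_sub_eq_zero s j fun k => ?_
      rw [inner_sub_right]
      by_cases hk : k = i
      · subst hk; linarith
      · rw [hfac k hk, sub_self]
    have h1 := hn.norm_eq_one
    rw [hf0, norm_zero] at h1
    exact zero_ne_one h1
  · intro k l
    rw [inner_sub_right]
    by_cases hk : k = i <;> by_cases hl : l = i
    · simp [hk, hl]
    · simp [hk, hl, hfac l hl]
    · simp [hk, hl, hfac k hk]
    · simp [hk, hl, hfac k hk, hfac l hl]

/-- The height of the simplex over the facet opposite to its `i`-th vertex. -/
noncomputable def facetHeight (i : Fin (n + 1)) : ℝ :=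
  (exists_inner_unitOuterNormal s i).choose

theorem facetHeight_pos (i : Fin (n + 1)) : 0 < facetHeight s i :=
  (exists_inner_unitOuterNormal s i).choose_spec.1

theorem inner_unitOuterNormal (i k l : Fin (n + 1)) :
    ⟪unitOuterNormal s i, s.points k - s.points l⟫ =
      facetHeight s i * ((if l = i then 1 else 0) - (if k = i then 1 else 0)) :=
  (exists_inner_unitOuterNormal s i).choose_spec.2 k l

/-! ### Prisms and the constancy of area times height -/

/-- The prism over the facet opposite to the `i`-th vertex, with generating segment parallel to
the edge from the `j`-th to the `i`-th vertex. -/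
def prism (i j : Fin (n + 1)) : Set (EuclideanSpace ℝ (Fin n)) :=
  (s.faceOpposite i).closedInterior + segment ℝ 0 (s.points i - s.points j)

theorem volume_prism {i j : Fin (n + 1)} (hij : i ≠ j) :
    volume (prism s i j) =
      μHE[n - 1] (s.faceOpposite i).closedInterior * ENNReal.ofReal (facetHeight s i) := by
  have hin : ⟪unitOuterNormal s i, s.points i - s.points j⟫ = -facetHeight s i := by
    rw [inner_unitOuterNormal]
    simp [hij.symm]
  have hn := unitOuterNormal_spec s i
  rw [prism, volume_add_segment (isCompact_closedInterior_faceOpposite s i) hn.norm_eq_one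
    (p := s.points j) (hn.inner_facet _ (point_mem_closedInterior_faceOpposite s hij.symm))
    (by rw [hin]; exact neg_ne_zero.2 (facetHeight_pos s i).ne'), hin, abs_neg,
    abs_of_pos (facetHeight_pos s i)]

theorem volume_prism_ne_top (i j : Fin (n + 1)) : volume (prism s i j) ≠ ⊤ := by
  refine ((isCompact_closedInterior_faceOpposite s i).add ?_).measure_lt_top.ne
  rw [← convexHull_pair]
  exact (Set.toFinite _).isCompact_convexHull ℝ

/-- The prism contains all vertices and is convex, so it contains the simplex, which has nonempty
interior. -/
theorem volume_prism_ne_zero {i j : Fin (n + 1)} (hij : i ≠ j) : volume (prism s i j) ≠ 0 := by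
  have hsub : convexHull ℝ (Set.range s.points) ⊆ prism s i j := by
    apply convexHull_min
    · rintro _ ⟨k, rfl⟩
      by_cases hk : k = i
      · subst hk
        exact ⟨_, point_mem_closedInterior_faceOpposite s hij.symm, _, right_mem_segment ℝ _ _,
          by simp⟩
      · exact ⟨_, point_mem_closedInterior_faceOpposite s hk, _, left_mem_segment ℝ _ _,
          by simp⟩
    · rw [prism, closedInterior_faceOpposite]
      exact (convex_convexHull ℝ _).add (convex_segment _ _)
  have hint : (interior (convexHull ℝ (Set.range s.points))).Nonempty := by
    rw [interior_convexHull_nonempty_iff_affineSpan_eq_top,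
      s.independent.affineSpan_eq_top_iff_card_eq_finrank_add_one]
    simp
  exact (lt_of_lt_of_le (isOpen_interior.measure_pos volume hint)
    (measure_mono (interior_subset.trans hsub))).ne'

/-- The reflection need not be orthogonal, but it is an involution, so its determinant is `±1`. -/
theorem volume_image_reflection {E : Type*} [NormedAddCommGroup E] [InnerProductSpace ℝ E]
    [FiniteDimensional ℝ E] [MeasurableSpace E] [BorelSpace E] {d : E} {φ : Dual ℝ E}
    (h : φ d = 2) (t : Set E) : volume (reflection h '' t) = volume t := by
  have hinv : (reflection h : E →ₗ[ℝ] E) ∘ₗ (reflection h : E →ₗ[ℝ] E) = LinearMap.id :=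
    LinearMap.ext (involutive_reflection h)
  have hdet := congrArg LinearMap.det hinv
  rw [LinearMap.det_comp, LinearMap.det_id, ← abs_mul_abs_self] at hdet
  have habs : |LinearMap.det (reflection h : E →ₗ[ℝ] E)| = 1 := by
    have h0 := abs_nonneg (LinearMap.det (reflection h : E →ₗ[ℝ] E))
    nlinarith
  have := Measure.addHaar_image_linearMap volume (reflection h : E →ₗ[ℝ] E) t
  rwa [habs, ENNReal.ofReal_one, one_mul] at this

/-- The affine involution swapping the `i`-th and the `j`-th vertex carries one prism to the
other, and preserves the volume. -/
theorem volume_prism_comm {i j : Fin (n + 1)} (hij : i ≠ j) :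
    volume (prism s i j) = volume (prism s j i) := by
  set d := s.points i - s.points j with hd
  -- `φ` is the linear part of the difference of the `i`-th and `j`-th barycentric coordinates: it
  -- is `2` on `d` and vanishes on edges avoiding `v_i` and `v_j`.
  let φ : Dual ℝ (EuclideanSpace ℝ (Fin n)) :=
    (innerSL ℝ ((facetHeight s j)⁻¹ • unitOuterNormal s j -
      (facetHeight s i)⁻¹ • unitOuterNormal s i)).toLinearMap
  have hφ : ∀ k l, φ (s.points k - s.points l) =
      ((if l = j then 1 else 0) - (if k = j then 1 else 0)) -
        ((if l = i then 1 else 0) - (if k = i then 1 else 0)) := by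
    intro k l
    have h1 := (facetHeight_pos s i).ne'
    have h2 := (facetHeight_pos s j).ne'
    simp only [φ, ContinuousLinearMap.coe_coe, innerSL_apply_apply, inner_sub_left,
      real_inner_smul_left, inner_unitOuterNormal]
    rw [inv_mul_cancel_left₀ h1, inv_mul_cancel_left₀ h2]
  have h2 : φ d = 2 := by
    rw [hd, hφ]
    simp [hij, hij.symm]
    norm_num
  -- The reflection is linear and fixes the origin rather than a point of the simplex, so it swaps
  -- the vertices only up to the translation by `u`.
  set u := reflection h2 (s.points i) - s.points j with hu
  have hpt : ∀ k, reflection h2 (s.points k) = u + s.points (Equiv.swap i j k) := by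
    intro k
    have e : reflection h2 (s.points k) =
        reflection h2 (s.points i) + reflection h2 (s.points k - s.points i) := by
      rw [← map_add, add_sub_cancel]
    rw [e, hu, reflection_apply (s.points k - s.points i), hφ]
    by_cases hki : k = i
    · subst hki
      simp
    by_cases hkj : k = j
    · subst hkj
      simp only [hki, hij, if_true, if_false, Equiv.swap_apply_right]
      linear_combination (norm := module) (2 : ℝ) • hd
    · simp only [hki, hkj, hij, if_true, if_false, Equiv.swap_apply_of_ne_of_ne hki hkj]
      linear_combination (norm := module) hd
  have himg : reflection h2 '' (s.points '' {i}ᶜ) = u +ᵥ s.points '' {j}ᶜ := by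
    ext z
    constructor
    · rintro ⟨_, ⟨k, hk, rfl⟩, rfl⟩
      refine ⟨_, ⟨Equiv.swap i j k, ?_, rfl⟩, (hpt k).symm⟩
      intro h
      exact hk ((Equiv.swap i j).injective (by simpa using h))
    · rintro ⟨_, ⟨k, hk, rfl⟩, rfl⟩
      refine ⟨_, ⟨Equiv.swap i j k, ?_, rfl⟩, ?_⟩
      · intro h
        exact hk ((Equiv.swap i j).injective (by simpa using h))
      · rw [hpt]
        simp
  have hface : reflection h2 '' (s.faceOpposite i).closedInterior =
      u +ᵥ (s.faceOpposite j).closedInterior := by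
    rw [closedInterior_faceOpposite, closedInterior_faceOpposite, ← convexHull_vadd, ← himg]
    exact (reflection h2).toLinearMap.image_convexHull _
  have hsegm : reflection h2 '' segment ℝ 0 (s.points i - s.points j) =
      segment ℝ 0 (s.points j - s.points i) := by
    have h := image_segment ℝ
      (reflection h2).toLinearMap.toAffineMap 0 d
    simp only [LinearMap.coe_toAffineMap, LinearEquiv.coe_coe, map_zero] at h
    rw [← hd, h, reflection_apply_self, hd, neg_sub]
  rw [← volume_image_reflection h2, prism, Set.image_add, hface, hsegm, vadd_add_assoc,
    measure_vadd, prism]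

theorem facetArea_mul_facetHeight {i j : Fin (n + 1)} (hij : i ≠ j) :
    facetArea s i * facetHeight s i = volume.real (prism s i j) := by
  rw [measureReal_def, volume_prism s hij, ENNReal.toReal_mul,
    ENNReal.toReal_ofReal (facetHeight_pos s i).le, facetArea, measureReal_def]

theorem exists_facetArea_mul_facetHeight :
    ∃ V : ℝ, V ≠ 0 ∧ ∀ i, facetArea s i * facetHeight s i = V := by
  have hne : (0 : Fin (n + 1)) ≠ Fin.last n := (Fin.last_pos' (n := n)).ne
  refine ⟨volume.real (prism s 0 (Fin.last n)), ?_, fun i => ?_⟩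
  · rw [measureReal_def]
    exact ENNReal.toReal_ne_zero.2 ⟨volume_prism_ne_zero s hne, volume_prism_ne_top s _ _⟩
  -- The prism volume does not depend on its second index, so facet `0` serves as the common
  -- reference.
  · rw [← facetArea_mul_facetHeight s hne]
    by_cases hi : i = 0
    · rw [hi]
    · rw [facetArea_mul_facetHeight s hi, facetArea_mul_facetHeight s (Ne.symm hi),
        measureReal_def, measureReal_def, volume_prism_comm s hi]

/-! ### Minkowski's relation and the kernel of the Gram matrix -/

/-- Minkowski's relation. -/
theorem sum_facetArea_smul_unitOuterNormal :
    ∑ i, facetArea s i • unitOuterNormal s i = 0 := by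
  obtain ⟨V, -, hV⟩ := exists_facetArea_mul_facetHeight s
  refine eq_zero_of_inner_points_sub_eq_zero s 0 fun k => ?_
  simp only [sum_inner, real_inner_smul_left, inner_unitOuterNormal, ← mul_assoc, hV]
  rw [← Finset.mul_sum]
  simp

theorem dualGram_eq_gram : dualGram s = Matrix.gram ℝ (unitOuterNormal s) := rfl

theorem dualGram_mulVec (x : Fin (n + 1) → ℝ) (i : Fin (n + 1)) :
    (dualGram s).mulVec x i = ⟪unitOuterNormal s i, ∑ j, x j • unitOuterNormal s j⟫ := by
  simp only [Matrix.mulVec, dotProduct, dualGram, Matrix.of_apply, inner_sum,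
    real_inner_smul_right, mul_comm]

theorem dualGram_mulVec_eq_zero_iff (x : Fin (n + 1) → ℝ) :
    (dualGram s).mulVec x = 0 ↔ ∑ j, x j • unitOuterNormal s j = 0 := by
  constructor
  · intro h
    -- The squared norm of `∑ x_j f_j` is the quadratic form of the Gram matrix at `x`.
    rw [← inner_self_eq_zero (𝕜 := ℝ), sum_inner]
    refine Finset.sum_eq_zero fun i _ => ?_
    rw [real_inner_smul_left, ← dualGram_mulVec, h, Pi.zero_apply, mul_zero]
  · intro h
    ext i
    rw [dualGram_mulVec, h, inner_zero_right, Pi.zero_apply]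

theorem facetArea_ne_zero : facetArea s ≠ 0 := by
  obtain ⟨V, hV0, hV⟩ := exists_facetArea_mul_facetHeight s
  intro h
  apply hV0
  rw [← hV 0, h, Pi.zero_apply, zero_mul]

theorem ker_dualGram :
    LinearMap.ker (Matrix.toLin' (dualGram s)) = Submodule.span ℝ {facetArea s} := by
  obtain ⟨V, hV0, hV⟩ := exists_facetArea_mul_facetHeight s
  ext x
  rw [LinearMap.mem_ker, Matrix.toLin'_apply, dualGram_mulVec_eq_zero_iff,
    Submodule.mem_span_singleton]
  constructor
  · intro h
    have hx : ∀ k, x k * facetHeight s k = x 0 * facetHeight s 0 := by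
      intro k
      have h1 : ⟪∑ j, x j • unitOuterNormal s j, s.points 0 - s.points k⟫ = 0 := by
        rw [h, inner_zero_left]
      simp only [sum_inner, real_inner_smul_left, inner_unitOuterNormal, ← mul_assoc] at h1
      simp only [mul_sub, Finset.sum_sub_distrib, mul_ite, mul_one, mul_zero,
        Finset.sum_ite_eq, Finset.mem_univ, if_true] at h1
      linarith
    -- Forced by `x_k = x_0 h_0 / h_k` and `A_k = V / h_k`.
    refine ⟨x 0 * facetHeight s 0 / V, ?_⟩
    ext k
    have hk := (facetHeight_pos s k).ne'
    rw [Pi.smul_apply, smul_eq_mul, ← hx k, ← hV k]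
    have : facetArea s k ≠ 0 := left_ne_zero_of_mul (hV k ▸ hV0)
    field_simp
  · rintro ⟨c, rfl⟩
    simp only [Pi.smul_apply, smul_assoc]
    rw [← Finset.smul_sum, sum_facetArea_smul_unitOuterNormal, smul_zero]

theorem finrank_ker_dualGram :
    finrank ℝ (LinearMap.ker (Matrix.toLin' (dualGram s))) = 1 := by
  rw [ker_dualGram, finrank_span_singleton (facetArea_ne_zero s)]

/-- For a Hermitian matrix, the algebraic multiplicity of the eigenvalue zero is the dimension of
the kernel. -/
theorem _root_.Matrix.IsHermitian.rootMultiplicity_zero_charpoly {m : Type*} [Fintype m]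
    [DecidableEq m] {A : Matrix m m ℝ} (hA : A.IsHermitian) :
    A.charpoly.rootMultiplicity 0 = finrank ℝ (LinearMap.ker (Matrix.toLin' A)) := by
  have h1 : A.charpoly.rootMultiplicity 0 = Fintype.card {i // hA.eigenvalues i = 0} := by
    rw [← Polynomial.count_roots, hA.roots_charpoly_eq_eigenvalues, Multiset.count_map,
      Fintype.card_subtype]
    simp only [Function.comp_apply, RCLike.ofReal_real_eq_id, id_eq, eq_comm (a := (0 : ℝ))]
    rfl
  have h2 := hA.rank_eq_card_non_zero_eigs
  have h3 := LinearMap.finrank_range_add_finrank_ker (Matrix.toLin' A)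
  rw [← Matrix.toLin_eq_toLin'] at h3 ⊢
  have h4 : Fintype.card {i // hA.eigenvalues i ≠ 0} =
      Fintype.card m - Fintype.card {i // hA.eigenvalues i = 0} := by
    rw [← Fintype.card_subtype_compl]
  have h5 := Fintype.card_subtype_le (fun i => hA.eigenvalues i = 0)
  rw [← Matrix.rank_eq_finrank_range_toLin A (Pi.basisFun ℝ m) (Pi.basisFun ℝ m),
    finrank_fintype_fun_eq_card] at h3
  omega

end EuclideanSimplex

theorem mainTheorem9 (n : ℕ) [NeZero n]
    (s : Affine.Simplex ℝ (EuclideanSpace ℝ (Fin n)) n) :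
    (EuclideanSimplex.dualGram s).IsSymm ∧
    (EuclideanSimplex.dualGram s).PosSemidef ∧
    (EuclideanSimplex.dualGram s).charpoly.rootMultiplicity 0 = 1 ∧
    Module.finrank ℝ (LinearMap.ker (Matrix.toLin' (EuclideanSimplex.dualGram s))) = 1 ∧
    ∑ i, EuclideanSimplex.facetArea s i • EuclideanSimplex.unitOuterNormal s i = 0 ∧
    LinearMap.ker (Matrix.toLin' (EuclideanSimplex.dualGram s)) =
      Submodule.span ℝ {EuclideanSimplex.facetArea s} := by
  have hpsd : (EuclideanSimplex.dualGram s).PosSemidef :=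
    EuclideanSimplex.dualGram_eq_gram s ▸ Matrix.posSemidef_gram ℝ _
  refine ⟨?_, hpsd, ?_, EuclideanSimplex.finrank_ker_dualGram s,
    EuclideanSimplex.sum_facetArea_smul_unitOuterNormal s, EuclideanSimplex.ker_dualGram s⟩
  · ext i j
    exact real_inner_comm (EuclideanSimplex.unitOuterNormal s i) _
  · rw [hpsd.isHermitian.rootMultiplicity_zero_charpoly, EuclideanSimplex.finrank_ker_dualGram s]
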